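/- All MDPs are finite and given by mean rewards and transition probabilities. Let $M=(\mathcal S,\mathcal A,r,p)$ be an MDP with finite state space $\mathcal S$, finite nonempty action set $\mathcal A$ and mean rewards $r(s,a)\in[0,1]$. Assume that $M$ is communicating, that is, for all $s,s'\in\mathcal S$ there is a finite sequence of actions that leads from $s$ to $s'$ with positive probability. Let $\bar M=(\bar{\mathcal S},\mathcal A,\bar r,\bar p)$ be an MDP with finite state space $\bar{\mathcal S}$ that is an $\epsilon$-approximation of $M$: there is a surjective map $\alpha:\mathcal S\to\bar{\mathcal S}$ such that for all $s\in\mathcal S$ and $a\in\mathcal A$ $$|\bar r(\alpha(s),a)-r(s,a)|<\epsilon \quad\text{and}\quad \sum_{\dot s'\in\bar{\mathcal S}}\Big|\bar p(\dot s'\mid\alpha(s),a)-\sum_{s':\alpha(s')=\dot s'}p(s'\mid s,a)\Big|<\epsilon .$$ For an MDP and an initial state $s$ let $\rho^*(\cdot,s)=\max_\pi\lim_{T\to\infty}\frac1T\,\mathbb E\big[\sum_{t=1}^{T}r_t\big]$ be the optimal average reward, where $\pi$ ranges over the policies that map states to actions and $r_t$ are the rewards obtained when following $\pi$ from $s$.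 Let $D(M)=\max_{s\neq s'}\min_\pi\mathbb E[\tau_\pi(s\to s')]$ be the diameter of $M$, where $\tau_\pi(s\to s')$ is the first time at which $s'$ is reached from $s$ under $\pi$ ($D(M)=0$ if there is only one state). Then $D(M)<\infty$, the value $\rho^*(M):=\rho^*(M,s)$ does not depend on $s$, and for every initial state $\dot s\in\bar{\mathcal S}$ $$\big|\rho^*(M)-\rho^*(\bar M,\dot s)\big|\;\le\;\epsilon\,(D(M)+1).$$ -/

import Mathlib

open Filter Topology
open scoped ENNReal Matrix

/-- A Markov decision process with finite state space `S` and action space `A`, given by its mean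
rewards `r s a` and its transition probabilities `p s a s' = p(s' | s, a)`. -/
structure MDP (S A : Type*) [Fintype S] where
  r : S → A → ℝ
  p : S → A → S → ℝ
  p_nonneg : ∀ s a s', 0 ≤ p s a s'
  p_sum : ∀ s a, ∑ s', p s a s' = 1

namespace MDP

section
variable {S A : Type*} [Fintype S] [DecidableEq S]

/-- The transition matrix of the Markov chain that a policy `π : S → A` induces. -/
def transition (M : MDP S A) (π : S → A) : Matrix S S ℝ :=
  Matrix.of fun s s' => M.p s (π s) s'

/-- The expected reward `𝔼[r(s_t, π(s_t))]` in step `t` when `π` is followed from `s_0 = s`: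
the state `s_t` has the distribution `(transition π ^ t) s ·`. -/
def expectedReward (M : MDP S A) (π : S → A) (s : S) (t : ℕ) : ℝ :=
  ∑ s', (M.transition π ^ t) s s' * M.r s' (π s')

/-- The average reward `lim_{T → ∞} (1/T) 𝔼[∑_{t < T} r(s_t, π(s_t))]` of the policy `π` when
starting in `s`. The limit always exists, see `tendsto_averageReward`. -/
noncomputable def averageReward (M : MDP S A) (π : S → A) (s : S) : ℝ :=
  limUnder atTop fun T : ℕ => (∑ t ∈ Finset.range T, M.expectedReward π s t) / (T : ℝ)

/-- The optimal average reward `ρ*(M)` when starting in `s`: the largest average reward of a policy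
(there are finitely many policies if `S` and `A` are finite). -/
noncomputable def optimalReward (M : MDP S A) (s : S) : ℝ :=
  ⨆ π : S → A, M.averageReward π s

/-- `M.notReached π g t s` is the probability that none of the states `s_0, …, s_t` is the goal `g`
when `π` is followed from `s_0 = s`. -/
def notReached (M : MDP S A) (π : S → A) (g : S) : ℕ → S → ℝ
  | 0, s => if s = g then 0 else 1
  | t + 1, s => if s = g then 0 else ∑ u, M.p s (π s) u * M.notReached π g t u

/-- The expectation, in `[0, ∞]`, of the first time `τ` at which the goal `g` is reached when `π` is
followed from `s`, as `𝔼[τ] = ∑_{t ≥ 0} ℙ(τ > t)`. -/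
noncomputable def expectedHittingTime (M : MDP S A) (π : S → A) (s g : S) : ℝ≥0∞ :=
  ∑' t : ℕ, ENNReal.ofReal (M.notReached π g t s)

/-- The diameter `D(M) = max_{s ≠ g} min_π 𝔼[τ(s → g)]`, with values in `[0, ∞]`. -/
noncomputable def diameter (M : MDP S A) : ℝ≥0∞ :=
  ⨆ (s : S) (g : S) (_ : s ≠ g), ⨅ π : S → A, M.expectedHittingTime π s g

/-- The probability of being in the state `g` after taking the given actions one after the other,
starting in the given state. -/
def reachProb (M : MDP S A) (g : S) : List A → S → ℝ
  | [], s => if s = g then 1 else 0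
  | a :: l, s => ∑ u, M.p s a u * M.reachProb g l u

/-- For all states `s` and `g` there is a sequence of actions that leads from `s` to `g` with
positive probability. -/
def IsCommunicating (M : MDP S A) : Prop :=
  ∀ s g : S, ∃ l : List A, 0 < M.reachProb g l s

end

/-- `N` (with states `S'`) is an `ε`-approximation of `M` (with states `S`). -/
def IsApproximation {S S' A : Type*} [Fintype S] [Fintype S'] [DecidableEq S']
    (ε : ℝ) (M : MDP S A) (N : MDP S' A) : Prop :=
  ∃ α : S → S', Function.Surjective α ∧ ∀ s a,
    |N.r (α s) a - M.r s a| < ε ∧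
    ∑ u : S', |N.p (α s) a u - ∑ s' with α s' = u, M.p s a s'| < ε

section
variable {S A : Type*} [Fintype S] [DecidableEq S]

/-- The limit in the definition of the average reward exists. -/
theorem tendsto_averageReward (M : MDP S A) (π : S → A) (s : S) :
    Tendsto (fun T : ℕ => (∑ t ∈ Finset.range T, M.expectedReward π s t) / (T : ℝ)) atTop
      (𝓝 (M.averageReward π s)) := by
  refine tendsto_nhds_limUnder ?_
  set P := M.transition π with hP
  -- the transition matrix does not increase the sup norm
  have hcontr : ∀ x : S → ℝ, ‖P *ᵥ x‖ ≤ ‖x‖ := by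
    intro x
    refine (pi_norm_le_iff_of_nonneg (norm_nonneg x)).2 fun i => ?_
    calc ‖(P *ᵥ x) i‖ ≤ ∑ j, ‖P i j * x j‖ := norm_sum_le _ _
      _ ≤ ∑ j, P i j * ‖x‖ := by
        refine Finset.sum_le_sum fun j _ => ?_
        have h0 : 0 ≤ P i j := M.p_nonneg i (π i) j
        rw [norm_mul, Real.norm_of_nonneg h0]
        exact mul_le_mul_of_nonneg_left (norm_le_pi_norm x j) h0
      _ = ‖x‖ := by
        rw [← Finset.sum_mul]
        have h1 : ∑ j, P i j = 1 := M.p_sum i (π i)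
        rw [h1, one_mul]
  have hpow : ∀ (n : ℕ) (x : S → ℝ), ‖(P ^ n) *ᵥ x‖ ≤ ‖x‖ := by
    intro n x
    induction n with
    | zero => simp
    | succ n ih =>
      rw [pow_succ', ← Matrix.mulVec_mulVec]
      exact (hcontr _).trans ih
  -- fixed vectors stay fixed, and sums along an increment telescope
  have hfix : ∀ (y : S → ℝ), P *ᵥ y = y → ∀ n : ℕ, (P ^ n) *ᵥ y = y := by
    intro y hy n
    induction n with
    | zero => simp
    | succ n ih => rw [pow_succ, ← Matrix.mulVec_mulVec, hy, ih]
  have htel : ∀ (z : S → ℝ) (n : ℕ),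
      ∑ t ∈ Finset.range n, (P ^ t) *ᵥ (P *ᵥ z - z) = (P ^ n) *ᵥ z - z := by
    intro z n
    have h := Finset.sum_range_sub (fun t => (P ^ t) *ᵥ z) n
    rw [pow_zero, Matrix.one_mulVec] at h
    rw [← h]
    refine Finset.sum_congr rfl fun t _ => ?_
    rw [Matrix.mulVec_sub, Matrix.mulVec_mulVec, ← pow_succ]
  let f : (S → ℝ) →ₗ[ℝ] (S → ℝ) := Matrix.toLin' P - LinearMap.id
  have hf : ∀ x, f x = P *ᵥ x - x := fun x => by simp [f]
  have hdisj : Disjoint (LinearMap.range f) (LinearMap.ker f) := by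
    rw [Submodule.disjoint_def]
    rintro x ⟨z, rfl⟩ hx
    set x := f z with hxz
    have hPx : P *ᵥ x = x := by
      rw [LinearMap.mem_ker, hf] at hx
      exact sub_eq_zero.1 hx
    have hn : ∀ n : ℕ, (n : ℝ) * ‖x‖ ≤ 2 * ‖z‖ := by
      intro n
      have h1 := htel z n
      rw [← hf z, ← hxz, Finset.sum_congr rfl fun t _ => hfix x hPx t, Finset.sum_const,
        Finset.card_range] at h1
      calc (n : ℝ) * ‖x‖ = ‖n • x‖ := by
            rw [← Nat.cast_smul_eq_nsmul ℝ, norm_smul, Real.norm_natCast]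
        _ ≤ ‖(P ^ n) *ᵥ z‖ + ‖z‖ := by rw [h1]; exact norm_sub_le _ _
        _ ≤ 2 * ‖z‖ := by linarith [hpow n z]
    by_contra hne
    have hpos : 0 < ‖x‖ := norm_pos_iff.2 hne
    obtain ⟨n, hn'⟩ := exists_nat_gt (2 * ‖z‖ / ‖x‖)
    rw [div_lt_iff₀ hpos] at hn'
    exact absurd (hn n) (not_le.2 hn')
  have htop : LinearMap.range f ⊔ LinearMap.ker f = ⊤ :=
    Submodule.eq_top_of_disjoint _ _ (LinearMap.finrank_range_add_finrank_ker f).ge hdisj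
  obtain ⟨_, ⟨z, rfl⟩, y, hy, hxy⟩ :=
    Submodule.mem_sup.1 (htop ▸ Submodule.mem_top :
      (fun s' => M.r s' (π s')) ∈ LinearMap.range f ⊔ LinearMap.ker f)
  have hPy : P *ᵥ y = y := by
    rw [LinearMap.mem_ker, hf] at hy
    exact sub_eq_zero.1 hy
  have hsum : ∀ T : ℕ, ∑ t ∈ Finset.range T, M.expectedReward π s t
      = (((P ^ T) *ᵥ z) s - z s) + T * y s := by
    intro T
    have h1 : ∀ t, M.expectedReward π s t = ((P ^ t) *ᵥ (P *ᵥ z - z)) s + y s := by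
      intro t
      have : M.expectedReward π s t = ((P ^ t) *ᵥ (fun s' => M.r s' (π s'))) s := rfl
      rw [this, ← hxy, Matrix.mulVec_add, hfix y hPy, hf]
      rfl
    rw [Finset.sum_congr rfl fun t _ => h1 t, Finset.sum_add_distrib, Finset.sum_const,
      Finset.card_range, nsmul_eq_mul, ← Finset.sum_apply, htel]
    rfl
  refine ⟨y s, ?_⟩
  have hlim : Tendsto (fun T : ℕ => (((P ^ T) *ᵥ z) s - z s) / (T : ℝ)) atTop (𝓝 0) := by
    refine squeeze_zero_norm (a := fun T : ℕ => (2 * ‖z‖) / (T : ℝ)) (fun T => ?_)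
      (tendsto_const_div_atTop_nhds_zero_nat _)
    rw [norm_div, Real.norm_natCast]
    refine div_le_div_of_nonneg_right ?_ (Nat.cast_nonneg T)
    have h1 := norm_sub_le (((P ^ T) *ᵥ z) s) (z s)
    have h2 := norm_le_pi_norm ((P ^ T) *ᵥ z) s
    have h3 := norm_le_pi_norm z s
    linarith [hpow T z]
  have hlim' := hlim.add_const (y s)
  rw [zero_add] at hlim'
  refine hlim'.congr' ?_
  filter_upwards [eventually_gt_atTop 0] with T hT
  have hT' : (T : ℝ) ≠ 0 := by exact_mod_cast hT.ne'
  rw [hsum, add_div, mul_div_cancel_left₀ _ hT']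

end

end MDP

/-! The proof is by vanishing discount. For `β < 1` let `V` and `U` solve the discounted optimality
equations of `M` and `N`.

Since each policy's rewards split as `P z - z + y` with `y` its average reward, `(1 - β) V` and `(1
- β) U` differ from the optimal average rewards by `O(1 - β)`, uniformly over the finitely many
policies (`exists_abs_discounted_sub_optimalReward_le`).

Heading for `g` costs at most one unit of value per step, so `V` has span at most `D(M)`
(`sub_le_diameter`). Hence replacing the transitions of `M` by those of `N` changes a one-step
expectation of `V` by at most `ε D(M)`, and the rewards add `ε`. The difference of `V` and `U ∘ α`
thus obeys a discounted inequality with source `ε (D(M) + 1)`, which bounds it after multiplication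
by `1 - β` (`abs_sub_le`). Only the span of `V` enters, so `N` need not be communicating. Finally `β
→ 1`. -/

/-! ### Maximum principle and discounted optimality equation -/

theorem MDP.mul_le_of_forall_bound {S : Type*} [Finite S] {x : S → ℝ} {β c : ℝ}
    (h : ∀ B, (∀ u, x u ≤ B) → ∀ s, x s ≤ c + β * B) (hβ : β < 1) (s : S) :
    (1 - β) * x s ≤ c := by
  have : Nonempty S := ⟨s⟩
  obtain ⟨m, hm⟩ := Finite.exists_max x
  -- Maximum principle: at a maximiser the best bound `B` is the value itself.
  have h1 := h (x m) hm m
  nlinarith [hm s]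

namespace MDP

section
variable {S A : Type*} [Fintype S]

theorem sum_p_mul_le (M : MDP S A) (s : S) (a : A) {x : S → ℝ} {B : ℝ} (h : ∀ u, x u ≤ B) :
    ∑ u, M.p s a u * x u ≤ B :=
  calc ∑ u, M.p s a u * x u ≤ ∑ u, M.p s a u * B :=
        Finset.sum_le_sum fun u _ => mul_le_mul_of_nonneg_left (h u) (M.p_nonneg s a u)
    _ = B := by rw [← Finset.sum_mul, M.p_sum, one_mul]

/-- `V` solves the optimality equation of `M` for the discount factor `β`. -/
def IsDiscountedOptimal (M : MDP S A) (β : ℝ) (V : S → ℝ) : Prop :=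
  (∀ s a, M.r s a + β * ∑ u, M.p s a u * V u ≤ V s) ∧
    ∀ s, ∃ a, V s = M.r s a + β * ∑ u, M.p s a u * V u

/-- The Bellman operator is a `β`-contraction in the sup norm; its fixed point is the solution. -/
theorem exists_isDiscountedOptimal [Fintype A] [Nonempty A] (M : MDP S A) {β : ℝ} (h0 : 0 ≤ β)
    (h1 : β < 1) : ∃ V, M.IsDiscountedOptimal β V := by
  let Q : (S → ℝ) → S → A → ℝ := fun v s a => M.r s a + β * ∑ u, M.p s a u * v u
  let T : (S → ℝ) → S → ℝ := fun v s => Finset.univ.sup' Finset.univ_nonempty (Q v s)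
  have hQ : ∀ v w s a, Q v s a ≤ Q w s a + β * dist v w := by
    intro v w s a
    have h2 : ∑ u, M.p s a u * (v u - w u) ≤ dist v w :=
      M.sum_p_mul_le s a fun u => (le_abs_self _).trans (dist_le_pi_dist v w u)
    simp only [mul_sub, Finset.sum_sub_distrib] at h2
    have := mul_le_mul_of_nonneg_left h2 h0
    simp only [Q]
    linarith
  have hT : ∀ v w s, T v s ≤ T w s + β * dist v w := fun v w s =>
    Finset.sup'_le _ _ fun a _ => (hQ v w s a).trans
      (by gcongr; exact Finset.le_sup' (Q w s) (Finset.mem_univ a))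
  have hc : ContractingWith (⟨β, h0⟩ : NNReal) T := by
    refine ⟨h1, LipschitzWith.of_dist_le_mul fun v w => ?_⟩
    refine (dist_pi_le_iff (mul_nonneg h0 dist_nonneg)).2 fun s => ?_
    rw [Real.dist_eq, abs_sub_le_iff]
    have h2 := hT v w s
    have h3 := hT w v s
    rw [dist_comm] at h3
    exact ⟨sub_le_iff_le_add'.2 h2, sub_le_iff_le_add'.2 h3⟩
  refine ⟨hc.fixedPoint, fun s a => ?_, fun s => ?_⟩
  · have h2 := congrFun hc.fixedPoint_isFixedPt s
    rw [← h2]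
    exact Finset.le_sup' (Q (hc.fixedPoint) s) (Finset.mem_univ a)
  · have h2 := congrFun hc.fixedPoint_isFixedPt s
    obtain ⟨a, -, ha⟩ :=
      Finset.exists_mem_eq_sup' Finset.univ_nonempty (Q (hc.fixedPoint) s)
    exact ⟨a, h2.symm.trans ha⟩

theorem IsDiscountedOptimal.nonneg [Nonempty A] {M : MDP S A} {β : ℝ} {V : S → ℝ}
    (hV : M.IsDiscountedOptimal β V) (hr : ∀ s a, 0 ≤ M.r s a) (h0 : 0 ≤ β) (h1 : β < 1) (s : S) :
    0 ≤ V s := by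
  have h := mul_le_of_forall_bound (x := fun s => -V s) (β := β) (c := 0) (fun B hB s => by
    obtain ⟨a⟩ := ‹Nonempty A›
    have h2 := mul_le_mul_of_nonneg_left (M.sum_p_mul_le s a hB) h0
    simp only [mul_neg, Finset.sum_neg_distrib] at h2
    have := hV.1 s a
    have := hr s a
    linarith) h1 s
  nlinarith

theorem IsDiscountedOptimal.mul_le_one {M : MDP S A} {β : ℝ} {V : S → ℝ}
    (hV : M.IsDiscountedOptimal β V) (hr : ∀ s a, M.r s a ≤ 1) (h0 : 0 ≤ β) (h1 : β < 1) (s : S) :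
    (1 - β) * V s ≤ 1 :=
  mul_le_of_forall_bound (fun B hB s => by
    obtain ⟨a, ha⟩ := hV.2 s
    have h2 := mul_le_mul_of_nonneg_left (M.sum_p_mul_le s a hB) h0
    have := hr s a
    linarith) h1 s

end

/-! ### Average rewards as limits of discounted values -/

section
variable {S A : Type*} [Fintype S] [DecidableEq S]

/-- The rewards of a policy are the sum of an increment and of a harmonic function, which is the
average reward. -/
theorem exists_poisson (M : MDP S A) (π : S → A) :
    ∃ z : S → ℝ, (∀ s, ∑ u, M.p s (π s) u * M.averageReward π u = M.averageReward π s) ∧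
      ∀ s, M.r s (π s) = ∑ u, M.p s (π s) u * z u - z s + M.averageReward π s := by
  set P := M.transition π with hP
  have hcontr : ∀ x : S → ℝ, ‖P *ᵥ x‖ ≤ ‖x‖ := fun x =>
    (pi_norm_le_iff_of_nonneg (norm_nonneg x)).2 fun i => by
      rw [Real.norm_eq_abs, abs_le']
      refine ⟨M.sum_p_mul_le i (π i) fun u => (le_abs_self _).trans (norm_le_pi_norm x u), ?_⟩
      have h := M.sum_p_mul_le i (π i) (x := -x) fun u =>
        (neg_le_abs (x u)).trans (norm_le_pi_norm x u)
      simp only [Pi.neg_apply, mul_neg, Finset.sum_neg_distrib] at h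
      exact h
  have hpow : ∀ (n : ℕ) (x : S → ℝ), ‖(P ^ n) *ᵥ x‖ ≤ ‖x‖ := by
    intro n x
    induction n with
    | zero => simp
    | succ n ih =>
      rw [pow_succ', ← Matrix.mulVec_mulVec]
      exact (hcontr _).trans ih
  have hsum : ∀ z y : S → ℝ, P *ᵥ y = y → ∀ n : ℕ,
      ∑ t ∈ Finset.range n, (P ^ t) *ᵥ (P *ᵥ z - z + y) = (P ^ n) *ᵥ z - z + n • y := by
    intro z y hy n
    have hfix : ∀ n : ℕ, (P ^ n) *ᵥ y = y := by
      intro n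
      induction n with
      | zero => simp
      | succ n ih => rw [pow_succ, ← Matrix.mulVec_mulVec, hy, ih]
    induction n with
    | zero => simp
    | succ n ih =>
      rw [Finset.sum_range_succ, ih, Matrix.mulVec_add, Matrix.mulVec_sub, Matrix.mulVec_mulVec,
        ← pow_succ, hfix, succ_nsmul]
      abel
  have hlim : ∀ (z y : S → ℝ) (s : S), Tendsto (fun T : ℕ =>
      ((P ^ T) *ᵥ z - z + T • y) s / (T : ℝ)) atTop (𝓝 (y s)) := by
    intro z y s
    have h0 : Tendsto (fun T : ℕ => ((P ^ T) *ᵥ z - z) s / (T : ℝ)) atTop (𝓝 0) := by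
      refine squeeze_zero_norm (a := fun T : ℕ => (2 * ‖z‖) / (T : ℝ)) (fun T => ?_)
        (tendsto_const_div_atTop_nhds_zero_nat _)
      rw [norm_div, Real.norm_natCast]
      gcongr
      have h1 := norm_le_pi_norm ((P ^ T) *ᵥ z - z) s
      have h2 := norm_sub_le ((P ^ T) *ᵥ z) z
      linarith [hpow T z]
    have h1 := h0.add_const (y s)
    rw [zero_add] at h1
    refine h1.congr' ?_
    filter_upwards [eventually_gt_atTop 0] with T hT
    have hT' : (T : ℝ) ≠ 0 := by exact_mod_cast hT.ne'
    rw [Pi.add_apply, Pi.smul_apply, nsmul_eq_mul, add_div, mul_div_cancel_left₀ _ hT']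
  let f : (S → ℝ) →ₗ[ℝ] (S → ℝ) := Matrix.toLin' P - LinearMap.id
  have hf : ∀ x, f x = P *ᵥ x - x := fun x => by simp [f]
  -- If `P z - z` is fixed by `P`, its Cesàro means equal it, yet they telescope to `0`. By
  -- dimension count the range and the kernel then span everything.
  have hdisj : Disjoint (LinearMap.range f) (LinearMap.ker f) := by
    rw [Submodule.disjoint_def]
    rintro x ⟨z, rfl⟩ hx
    rw [LinearMap.mem_ker, hf, sub_eq_zero] at hx
    rw [hf] at hx ⊢
    funext s
    have h1 := hlim z (-(P *ᵥ z - z)) s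
    have h2 : ∀ T : ℕ, (P ^ T) *ᵥ z - z + T • -(P *ᵥ z - z) = 0 := fun T => by
      rw [← hsum z _ (by rw [Matrix.mulVec_neg, hx]) T]
      exact Finset.sum_eq_zero fun t _ => by rw [add_neg_cancel, Matrix.mulVec_zero]
    simp only [h2, Pi.zero_apply, zero_div] at h1
    have h3 := tendsto_nhds_unique h1 tendsto_const_nhds
    rw [Pi.neg_apply, neg_eq_zero] at h3
    exact h3
  have htop : LinearMap.range f ⊔ LinearMap.ker f = ⊤ :=
    Submodule.eq_top_of_disjoint _ _ (LinearMap.finrank_range_add_finrank_ker f).ge hdisj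
  obtain ⟨_, ⟨z, rfl⟩, y, hy, hxy⟩ :=
    Submodule.mem_sup.1 (htop ▸ Submodule.mem_top :
      (fun s' => M.r s' (π s')) ∈ LinearMap.range f ⊔ LinearMap.ker f)
  rw [LinearMap.mem_ker, hf, sub_eq_zero] at hy
  rw [hf] at hxy
  have havg : M.averageReward π = y := by
    funext s
    refine tendsto_nhds_unique (M.tendsto_averageReward π s) ((hlim z y s).congr fun T => ?_)
    rw [← hsum z y hy T, Finset.sum_apply, hxy]
    rfl
  rw [havg]
  exact ⟨z, fun s => congrFun hy s, fun s => (congrFun hxy s).symm⟩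

theorem exists_averageReward_sub_le (M : MDP S A) (π : S → A) : ∃ C : ℝ, ∀ (β : ℝ) (V : S → ℝ),
    0 ≤ β → β < 1 →
    ((∀ s, M.r s (π s) + β * ∑ u, M.p s (π s) u * V u ≤ V s) →
      ∀ s, M.averageReward π s - (1 - β) * V s ≤ C * (1 - β)) ∧
    ((∀ s, V s ≤ M.r s (π s) + β * ∑ u, M.p s (π s) u * V u) →
      ∀ s, (1 - β) * V s - M.averageReward π s ≤ C * (1 - β)) := by
  obtain ⟨z, hy, hz⟩ := M.exists_poisson π
  set y := M.averageReward π
  have hz1 : ∀ u, z u ≤ ‖z‖ := fun u => (le_abs_self _).trans (norm_le_pi_norm z u)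
  have hz2 : ∀ u, -z u ≤ ‖z‖ := fun u => (neg_le_abs _).trans (norm_le_pi_norm z u)
  refine ⟨2 * ‖z‖, fun β V h0 h1 => ⟨fun h s => ?_, fun h s => ?_⟩⟩
  -- The corrector `z` cancels the first-order error: what remains is `-(1 - β) ^ 2 * P z`, so one
  -- factor `1 - β` survives the division by `1 - β`.
  · have key := mul_le_of_forall_bound (x := fun s => y s - (1 - β) * (z s + V s)) (β := β)
      (c := (1 - β) ^ 2 * ‖z‖) (fun B hB s => by
        have h2 := mul_le_mul_of_nonneg_left (M.sum_p_mul_le s (π s) hB) h0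
        have h3 := mul_le_mul_of_nonneg_left (M.sum_p_mul_le s (π s) hz2) (sq_nonneg (1 - β))
        have h4 := mul_le_mul_of_nonneg_left (h s) (sub_nonneg.2 h1.le)
        simp only [mul_neg, Finset.sum_neg_distrib] at h3
        simp only [mul_sub, mul_add, mul_left_comm _ (1 - β), Finset.sum_sub_distrib,
          Finset.sum_add_distrib, ← Finset.mul_sum, hy] at h2
        rw [hz] at h4
        nlinarith) h1 s
    have h2 : 0 < 1 - β := by linarith
    have h3 : y s - (1 - β) * (z s + V s) ≤ (1 - β) * ‖z‖ :=
      le_of_mul_le_mul_left (by nlinarith) h2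
    nlinarith [hz1 s]
  · have key := mul_le_of_forall_bound (x := fun s => (1 - β) * (z s + V s) - y s) (β := β)
      (c := (1 - β) ^ 2 * ‖z‖) (fun B hB s => by
        have h2 := mul_le_mul_of_nonneg_left (M.sum_p_mul_le s (π s) hB) h0
        have h3 := mul_le_mul_of_nonneg_left (M.sum_p_mul_le s (π s) hz1) (sq_nonneg (1 - β))
        have h4 := mul_le_mul_of_nonneg_left (h s) (sub_nonneg.2 h1.le)
        simp only [mul_sub, mul_add, mul_left_comm _ (1 - β), Finset.sum_sub_distrib,
          Finset.sum_add_distrib, ← Finset.mul_sum, hy] at h2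
        rw [hz] at h4
        nlinarith) h1 s
    have h2 : 0 < 1 - β := by linarith
    have h3 : (1 - β) * (z s + V s) - y s ≤ (1 - β) * ‖z‖ :=
      le_of_mul_le_mul_left (by nlinarith) h2
    nlinarith [hz2 s]

/-- The greedy policy of `V` gives the upper bound on `V`, and `V` dominates every policy.
Finiteness of the set of policies makes the constant uniform. -/
theorem exists_abs_discounted_sub_optimalReward_le [Finite A] (M : MDP S A) :
    ∃ C : ℝ, ∀ (β : ℝ) (V : S → ℝ), 0 ≤ β → β < 1 → M.IsDiscountedOptimal β V →
      ∀ s, |(1 - β) * V s - M.optimalReward s| ≤ C * (1 - β) := by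
  choose C hC using M.exists_averageReward_sub_le
  obtain ⟨K, hK⟩ := (Set.finite_range C).bddAbove
  have hCK : ∀ π, C π ≤ K := fun π => hK ⟨π, rfl⟩
  refine ⟨K, fun β V h0 h1 hV s => ?_⟩
  have h2 : 0 ≤ 1 - β := by linarith
  have hle : ∀ π, C π * (1 - β) ≤ K * (1 - β) := fun π =>
    mul_le_mul_of_nonneg_right (hCK π) h2
  choose a ha using hV.2
  have : Nonempty (S → A) := ⟨a⟩
  rw [abs_sub_le_iff]
  constructor
  · have h3 := (hC a β V h0 h1).2 (fun s => (ha s).le) s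
    have h4 : M.averageReward a s ≤ M.optimalReward s :=
      le_ciSup (f := fun π => M.averageReward π s) (Set.finite_range _).bddAbove a
    linarith [hle a]
  · have h3 : M.optimalReward s ≤ (1 - β) * V s + K * (1 - β) := ciSup_le fun π => by
      have h4 := (hC π β V h0 h1).1 (fun s => hV.1 s (π s)) s
      linarith [hle π]
    linarith

/-! ### Hitting times and finiteness of the diameter -/

theorem notReached_nonneg (M : MDP S A) (π : S → A) (g : S) (t : ℕ) (s : S) :
    0 ≤ M.notReached π g t s := by
  induction t generalizing s with
  | zero => rw [notReached]; split_ifs <;> norm_num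
  | succ t ih =>
    rw [notReached]
    split_ifs
    · rfl
    · exact Finset.sum_nonneg fun u _ => mul_nonneg (M.p_nonneg _ _ _) (ih u)

theorem sum_notReached_goal (M : MDP S A) (π : S → A) (g : S) (T : ℕ) :
    ∑ t ∈ Finset.range T, M.notReached π g t g = 0 :=
  Finset.sum_eq_zero fun t _ => by cases t <;> simp [notReached]

theorem sum_notReached_succ (M : MDP S A) (π : S → A) {g s : S} (h : s ≠ g) (T : ℕ) :
    ∑ t ∈ Finset.range (T + 1), M.notReached π g t s =
      1 + ∑ u, M.p s (π s) u * ∑ t ∈ Finset.range T, M.notReached π g t u := by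
  rw [Finset.sum_range_succ', add_comm]
  simp only [notReached, if_neg h, Finset.mul_sum]
  rw [Finset.sum_comm]

/-- Lyapunov criterion: `w` drops by at least one per expected step off the goal, so it dominates
every truncated hitting time. -/
theorem expectedHittingTime_le (M : MDP S A) (π : S → A) (g : S) {w : S → ℝ} (h0 : ∀ s, 0 ≤ w s)
    (hw : ∀ s, s ≠ g → 1 + ∑ u, M.p s (π s) u * w u ≤ w s) (s : S) :
    M.expectedHittingTime π s g ≤ ENNReal.ofReal (w s) := by
  have key : ∀ (T : ℕ) (s : S), ∑ t ∈ Finset.range T, M.notReached π g t s ≤ w s := by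
    intro T
    induction T with
    | zero => simpa using h0
    | succ T ih =>
      intro s
      by_cases h : s = g
      · rw [h, sum_notReached_goal]; exact h0 g
      · rw [sum_notReached_succ _ _ h]
        refine le_trans ?_ (hw s h)
        gcongr with u
        · exact M.p_nonneg _ _ _
        · exact ih u
  refine ENNReal.tsum_le_of_sum_range_le fun T => ?_
  rw [← ENNReal.ofReal_sum_of_nonneg fun t _ => M.notReached_nonneg π g t s]
  exact ENNReal.ofReal_le_ofReal (key T s)

/-- Here `d` is the least length of an action sequence reaching `g` with positive probability, and
`π` plays the first action of a shortest one. -/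
theorem IsCommunicating.exists_descent [Nonempty A] {M : MDP S A} (hM : M.IsCommunicating)
    (g : S) : ∃ (d : S → ℕ) (π : S → A), ∀ s, s ≠ g → ∃ u, d u < d s ∧ 0 < M.p s (π s) u := by
  classical
  have hex : ∀ s, ∃ k, ∃ l : List A, l.length = k ∧ 0 < M.reachProb g l s := fun s => by
    obtain ⟨l, hl⟩ := hM s g
    exact ⟨_, l, rfl, hl⟩
  have hstep : ∀ s, ∃ a, s ≠ g → ∃ u, Nat.find (hex u) < Nat.find (hex s) ∧ 0 < M.p s a u := by
    intro s
    obtain ⟨l, hl, hpos⟩ := Nat.find_spec (hex s)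
    cases l with
    | nil =>
      refine ⟨Classical.arbitrary A, fun hs => ?_⟩
      simp [reachProb, hs] at hpos
    | cons a l =>
      refine ⟨a, fun _ => ?_⟩
      rw [reachProb] at hpos
      obtain ⟨u, -, hu⟩ := Finset.exists_lt_of_sum_lt (f := fun _ => (0 : ℝ))
        (by simpa using hpos)
      have hp : 0 < M.p s a u := (M.p_nonneg s a u).lt_of_ne fun h => by simp [← h] at hu
      refine ⟨u, ?_, hp⟩
      rw [← hl, List.length_cons, Nat.lt_succ_iff]
      exact Nat.find_min' _ ⟨l, rfl, pos_of_mul_pos_right hu hp.le⟩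
  choose π hπ using hstep
  exact ⟨_, π, hπ⟩

theorem IsCommunicating.exists_expectedHittingTime_ne_top [Nonempty A] {M : MDP S A}
    (hM : M.IsCommunicating) (g : S) : ∃ π : S → A, ∀ s, M.expectedHittingTime π s g ≠ ⊤ := by
  obtain ⟨d, π, hd⟩ := hM.exists_descent g
  refine ⟨π, ?_⟩
  obtain ⟨δ, hδ0, hδ1, hδ⟩ : ∃ δ : ℝ, 0 < δ ∧ δ ≤ 1 ∧
      ∀ s u, 0 < M.p s (π s) u → δ ≤ M.p s (π s) u := by
    let q : S × S → ℝ := fun x => if 0 < M.p x.1 (π x.1) x.2 then M.p x.1 (π x.1) x.2 else 1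
    have hq : ∀ x, 0 < q x := fun x => by simp only [q]; split_ifs with h <;> simp [h]
    have : Nonempty (S × S) := ⟨(g, g)⟩
    obtain ⟨m, hm⟩ := Finite.exists_min q
    refine ⟨min (q m) 1, lt_min (hq m) one_pos, min_le_right _ _, fun s u h => ?_⟩
    have := hm (s, u)
    simp only [q, if_pos h] at this
    exact (min_le_left _ _).trans this
  obtain ⟨n, hn⟩ := (Set.finite_range d).bddAbove
  have hdn : ∀ s, d s ≤ n := fun s => hn ⟨s, rfl⟩
  -- With `w = c (1 - η ^ d)`, a descent has probability at least `δ = 2η`, which gives a drift of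
  -- at least `c * η ^ d s`; the choice of `c` makes this at least one.
  set η := δ / 2 with hη
  have hη0 : 0 < η := by positivity
  have hη1 : η ≤ 1 := by linarith
  set c := 1 / (η ^ n * η) with hc
  have hc0 : 0 < c := by positivity
  let w : S → ℝ := fun s => c * (1 - η ^ d s)
  have hw0 : ∀ s, 0 ≤ w s := fun s =>
    mul_nonneg hc0.le (sub_nonneg.2 (pow_le_one₀ hη0.le hη1))
  have hw : ∀ s, s ≠ g → 1 + ∑ u, M.p s (π s) u * w u ≤ w s := by
    intro s hs
    obtain ⟨v, hv, hpv⟩ := hd s hs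
    obtain ⟨k, hk⟩ : ∃ k, d s = k + 1 := ⟨d s - 1, by omega⟩
    have h1 : ∑ u, M.p s (π s) u * w u = c - c * ∑ u, M.p s (π s) u * η ^ d u := by
      simp only [w, mul_left_comm _ c, ← Finset.mul_sum]
      simp only [mul_sub, mul_one, Finset.sum_sub_distrib, M.p_sum]
    have h2 : δ * η ^ k ≤ ∑ u, M.p s (π s) u * η ^ d u :=
      calc δ * η ^ k ≤ M.p s (π s) v * η ^ d v :=
            mul_le_mul (hδ s v hpv) (pow_le_pow_of_le_one hη0.le hη1 (by omega))
              (by positivity) hpv.le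
        _ ≤ _ := Finset.single_le_sum (f := fun u => M.p s (π s) u * η ^ d u)
              (fun u _ => mul_nonneg (M.p_nonneg _ _ _) (by positivity)) (Finset.mem_univ v)
    have h3 : 1 ≤ c * (η ^ k * η) := by
      rw [hc, one_div_mul_eq_div, one_le_div (by positivity)]
      gcongr ?_ * _
      exact pow_le_pow_of_le_one hη0.le hη1 (by have := hdn s; omega)
    have h4 := mul_le_mul_of_nonneg_left h2 hc0.le
    rw [h1]
    simp only [w, hk, pow_succ]
    have h5 : δ = 2 * η := by rw [hη]; ring
    rw [h5] at h4
    linarith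
  exact fun s => ((M.expectedHittingTime_le π g hw0 hw s).trans_lt ENNReal.ofReal_lt_top).ne

theorem IsCommunicating.diameter_ne_top [Nonempty A] {M : MDP S A} (hM : M.IsCommunicating) :
    M.diameter ≠ ⊤ := by
  choose π hπ using hM.exists_expectedHittingTime_ne_top
  have h : M.diameter ≤ ∑ s, ∑ g, M.expectedHittingTime (π g) s g :=
    iSup_le fun s => iSup_le fun g => iSup_le fun _ => (iInf_le _ (π g)).trans <|
      (Finset.single_le_sum (f := fun g => M.expectedHittingTime (π g) s g)
        (fun _ _ => zero_le) (Finset.mem_univ g)).trans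
      (Finset.single_le_sum (f := fun s => ∑ g, M.expectedHittingTime (π g) s g)
        (fun _ _ => zero_le) (Finset.mem_univ s))
  refine (h.trans_lt ?_).ne
  exact ENNReal.sum_lt_top.2 fun s _ => ENNReal.sum_lt_top.2 fun g _ => (hπ g s).lt_top

theorem exists_expectedHittingTime_le_diameter [Finite A] [Nonempty A] (M : MDP S A) {s g : S}
    (h : s ≠ g) : ∃ π : S → A, M.expectedHittingTime π s g ≤ M.diameter := by
  obtain ⟨π, hπ⟩ := exists_eq_ciInf_of_finite (f := fun π : S → A => M.expectedHittingTime π s g)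
  refine ⟨π, hπ.le.trans ?_⟩
  exact le_iSup_of_le s (le_iSup_of_le g
    (le_iSup (fun _ : s ≠ g => ⨅ π : S → A, M.expectedHittingTime π s g) h))

/-! ### Span of the discounted value -/

/-- A step towards `g` forgoes at most `(1 - β) V g ≤ 1`, since rewards lie in `[0, 1]`. The last
term accounts for not having arrived by time `T` and vanishes as `T → ∞`. -/
theorem IsDiscountedOptimal.sub_le_sum_notReached [Nonempty A] {M : MDP S A} {β : ℝ} {V : S → ℝ}
    (hV : M.IsDiscountedOptimal β V) (hr : ∀ s a, M.r s a ∈ Set.Icc (0 : ℝ) 1) (h0 : 0 ≤ β)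
    (h1 : β < 1) (π : S → A) (g : S) (T : ℕ) (s : S) :
    V g - V s ≤ ∑ t ∈ Finset.range T, M.notReached π g t s + β ^ T * V g := by
  have hnn := hV.nonneg (fun s a => (hr s a).1) h0 h1
  induction T generalizing s with
  | zero => simpa using hnn s
  | succ T ih =>
    by_cases h : s = g
    · rw [h, sum_notReached_goal, sub_self, zero_add]
      exact mul_nonneg (pow_nonneg h0 _) (hnn g)
    · rw [sum_notReached_succ _ _ h]
      have h2 : ∑ u, M.p s (π s) u * (V g - V u - ∑ t ∈ Finset.range T, M.notReached π g t u) ≤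
          β ^ T * V g := M.sum_p_mul_le s (π s) fun u => by linarith [ih u]
      simp only [mul_sub, Finset.sum_sub_distrib, ← Finset.sum_mul, M.p_sum, one_mul] at h2
      have h3 := mul_le_mul_of_nonneg_left h2 h0
      have h4 : 0 ≤ ∑ u, M.p s (π s) u * ∑ t ∈ Finset.range T, M.notReached π g t u :=
        Finset.sum_nonneg fun u _ => mul_nonneg (M.p_nonneg _ _ _)
          (Finset.sum_nonneg fun t _ => M.notReached_nonneg _ _ _ _)
      have h5 := hV.mul_le_one (fun s a => (hr s a).2) h0 h1 g
      have h6 := hV.1 s (π s)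
      have h7 := (hr s (π s)).1
      have h8 := mul_le_mul_of_nonneg_right h1.le h4
      rw [pow_succ']
      linarith

theorem IsDiscountedOptimal.sub_le_diameter [Finite A] [Nonempty A] {M : MDP S A} {β : ℝ}
    {V : S → ℝ} (hV : M.IsDiscountedOptimal β V) (hr : ∀ s a, M.r s a ∈ Set.Icc (0 : ℝ) 1)
    (hD : M.diameter ≠ ⊤) (h0 : 0 ≤ β) (h1 : β < 1) (s g : S) :
    V g - V s ≤ M.diameter.toReal := by
  by_cases h : s = g
  · rw [h, sub_self]; exact ENNReal.toReal_nonneg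
  obtain ⟨π, hπ⟩ := M.exists_expectedHittingTime_le_diameter h
  have hsum : ∀ T : ℕ, ∑ t ∈ Finset.range T, M.notReached π g t s ≤ M.diameter.toReal := by
    intro T
    refine (ENNReal.ofReal_le_iff_le_toReal hD).1 ?_
    rw [ENNReal.ofReal_sum_of_nonneg fun t _ => M.notReached_nonneg π g t s]
    exact (ENNReal.sum_le_tsum _).trans hπ
  have hlim : Tendsto (fun T : ℕ => M.diameter.toReal + β ^ T * V g) atTop
      (𝓝 (M.diameter.toReal + 0 * V g)) :=
    ((tendsto_pow_atTop_nhds_zero_of_lt_one h0 h1).mul_const _).const_add _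
  rw [zero_mul, add_zero] at hlim
  exact ge_of_tendsto' hlim fun T =>
    (hV.sub_le_sum_notReached hr h0 h1 π g T s).trans (by gcongr; exact hsum T)

end

/-! ### Comparison of the two models -/

section
variable {S S' A : Type*} [Fintype S] [Fintype S'] [DecidableEq S']

/-- Comparison of the expectations of two functions `X` and `Y` under the transition probabilities
of an approximation and of the original model. -/
theorem sum_p_mul_le_of_aggregation (M : MDP S A) (N : MDP S' A) {ε D B : ℝ} {α : S → S'}
    (hα : Function.Surjective α) {s : S} {a : A}
    (hp : ∑ u : S', |N.p (α s) a u - ∑ s' with α s' = u, M.p s a s'| ≤ ε)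
    {X : S' → ℝ} {Y : S → ℝ} (hXY : ∀ u, X (α u) ≤ Y u + B) (hY : ∀ u v, Y u - Y v ≤ D) :
    ∑ u, N.p (α s) a u * X u ≤ ∑ u, M.p s a u * Y u + ε * D + B := by
  -- `Y` need not be constant on the fibres of `α`. Its fibrewise minimum still bounds `X` up to
  -- `B`, and averages to at most the mean of `Y`.
  have hmin : ∀ v, ∃ u, α u = v ∧ ∀ u', α u' = v → Y u ≤ Y u' := fun v => by
    obtain ⟨u₀, hu₀⟩ := hα v
    obtain ⟨u, hu, hu'⟩ := Finset.exists_min_image {u | α u = v} Y ⟨u₀, by simpa using hu₀⟩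
    exact ⟨u, by simpa using hu, fun u' h => hu' u' (by simpa using h)⟩
  choose σ hσ hmin using hmin
  have hD : 0 ≤ D := by simpa using hY s s
  set q : S' → ℝ := fun u => ∑ s' with α s' = u, M.p s a s' with hq
  have hfib : ∀ F : S' → ℝ, ∑ u, q u * F u = ∑ u, M.p s a u * F (α u) := by
    intro F
    rw [← Finset.sum_fiberwise Finset.univ α (fun u => M.p s a u * F (α u))]
    refine Finset.sum_congr rfl fun v _ => ?_
    rw [hq, Finset.sum_mul]
    refine Finset.sum_congr rfl fun u hu => ?_
    rw [(Finset.mem_filter.1 hu).2]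
  have hq1 : ∑ u, q u = 1 := by
    have := hfib fun _ => 1
    simpa [M.p_sum] using this
  have h1 : ∑ u, N.p (α s) a u * (X u - Y (σ u)) ≤ B :=
    N.sum_p_mul_le _ _ fun u => by have := hXY (σ u); rw [hσ] at this; linarith
  -- Both distributions have mass one, so subtracting the constant `Y s` is free and only the span
  -- of `Y` counts.
  have h2 : ∑ u, (N.p (α s) a u - q u) * (Y (σ u) - Y s) ≤ ε * D :=
    calc ∑ u, (N.p (α s) a u - q u) * (Y (σ u) - Y s)
        ≤ ∑ u, |N.p (α s) a u - q u| * D := Finset.sum_le_sum fun u _ => by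
          refine (le_abs_self _).trans ?_
          rw [abs_mul]
          exact mul_le_mul_of_nonneg_left (abs_sub_le_iff.2 ⟨hY _ _, hY _ _⟩) (abs_nonneg _)
      _ ≤ ε * D := by rw [← Finset.sum_mul]; exact mul_le_mul_of_nonneg_right hp hD
  have h3 : ∑ u, q u * Y (σ u) ≤ ∑ u, M.p s a u * Y u := by
    rw [hfib]
    exact Finset.sum_le_sum fun u _ =>
      mul_le_mul_of_nonneg_left (hmin (α u) u rfl) (M.p_nonneg s a u)
  simp only [mul_sub, sub_mul, Finset.sum_sub_distrib, ← Finset.sum_mul, N.p_sum, hq1] at h1 h2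
  linarith

theorem IsDiscountedOptimal.abs_sub_le {M : MDP S A} {N : MDP S' A} {β ε D : ℝ} {V : S → ℝ}
    {U : S' → ℝ} (hV : M.IsDiscountedOptimal β V) (hU : N.IsDiscountedOptimal β U)
    (h0 : 0 ≤ β) (h1 : β < 1) {α : S → S'} (hα : Function.Surjective α)
    (happ : ∀ s a, |N.r (α s) a - M.r s a| ≤ ε ∧
      ∑ u : S', |N.p (α s) a u - ∑ s' with α s' = u, M.p s a s'| ≤ ε)
    (hD : ∀ s g, V g - V s ≤ D) (s : S) :
    |(1 - β) * V s - (1 - β) * U (α s)| ≤ ε * (D + 1) := by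
  have hscale : ∀ (s : S) (a : A), β * (ε * D) ≤ ε * D := fun s a => by
    have hε : 0 ≤ ε := (abs_nonneg _).trans (happ s a).1
    have hD' : 0 ≤ D := by simpa using hD s s
    nlinarith [mul_nonneg hε hD']
  have hupper := mul_le_of_forall_bound (x := fun s => U (α s) - V s) (β := β)
    (c := ε * (D + 1)) (fun B hB s => by
      obtain ⟨a, ha⟩ := hU.2 (α s)
      have h2 := mul_le_mul_of_nonneg_left (sum_p_mul_le_of_aggregation M N hα (happ s a).2
        (X := U) (Y := V) (B := B) (fun u => by linarith [hB u]) (fun u v => hD v u)) h0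
      have h3 := (abs_sub_le_iff.1 (happ s a).1).1
      have h4 := hV.1 s a
      have h5 := hscale s a
      linarith) h1 s
  have hlower := mul_le_of_forall_bound (x := fun s => V s - U (α s)) (β := β)
    (c := ε * (D + 1)) (fun B hB s => by
      obtain ⟨a, ha⟩ := hV.2 s
      -- Negating both functions turns the one-sided comparison into the reverse one.
      have h2 := mul_le_mul_of_nonneg_left (sum_p_mul_le_of_aggregation M N hα (happ s a).2
        (X := fun u => -U u) (Y := fun u => -V u) (B := B) (D := D) (fun u => by linarith [hB u])
        (fun u v => by linarith [hD u v])) h0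
      simp only [mul_neg, Finset.sum_neg_distrib] at h2
      have h3 := (abs_sub_le_iff.1 (happ s a).1).2
      have h4 := hU.1 (α s) a
      have h5 := hscale s a
      linarith) h1 s
  rw [abs_sub_le_iff]
  constructor <;> linarith

end

end MDP

/-! ### Passage to the limit `β → 1` -/

theorem MDP.le_of_forall_discount {x y K : ℝ}
    (h : ∀ β : ℝ, 0 ≤ β → β < 1 → x ≤ y + K * (1 - β)) : x ≤ y := by
  have hlim : Tendsto (fun β : ℝ => y + K * (1 - β)) (𝓝[<] 1) (𝓝 (y + K * (1 - 1))) :=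
    (Continuous.tendsto (by fun_prop) 1).mono_left nhdsWithin_le_nhds
  rw [sub_self, mul_zero, add_zero] at hlim
  refine ge_of_tendsto hlim ?_
  filter_upwards [Ioo_mem_nhdsLT (zero_lt_one (α := ℝ))] with β hβ
  exact h β hβ.1.le hβ.2

theorem theorem1 {S S' A : Type*} [Fintype S] [DecidableEq S] [Fintype S'] [DecidableEq S']
    [Fintype A] [Nonempty A] (M : MDP S A) (N : MDP S' A) (ε : ℝ)
    (hr : ∀ s a, M.r s a ∈ Set.Icc (0 : ℝ) 1) (hM : M.IsCommunicating)
    (hN : MDP.IsApproximation ε M N) :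
    M.diameter ≠ ⊤ ∧
    (∀ s₁ s₂ : S, M.optimalReward s₁ = M.optimalReward s₂) ∧
    ∀ (s : S) (s' : S'),
      |M.optimalReward s - N.optimalReward s'| ≤ ε * (M.diameter.toReal + 1) := by
  have hD := hM.diameter_ne_top
  obtain ⟨C, hC⟩ := M.exists_abs_discounted_sub_optimalReward_le
  obtain ⟨C', hC'⟩ := N.exists_abs_discounted_sub_optimalReward_le
  have hle : ∀ s₁ s₂ : S, M.optimalReward s₁ ≤ M.optimalReward s₂ := fun s₁ s₂ =>
    -- `2 * C` pays for two passages between average and discounted reward, the diameter for the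
    -- span of `V`.
    MDP.le_of_forall_discount (K := 2 * C + M.diameter.toReal) fun β h0 h1 => by
      obtain ⟨V, hV⟩ := M.exists_isDiscountedOptimal h0 h1
      have h2 := (abs_sub_le_iff.1 (hC β V h0 h1 hV s₁)).2
      have h3 := (abs_sub_le_iff.1 (hC β V h0 h1 hV s₂)).1
      have h4 := mul_le_mul_of_nonneg_left (hV.sub_le_diameter hr hD h0 h1 s₂ s₁)
        (sub_nonneg.2 h1.le)
      linarith
  have heq : ∀ s₁ s₂ : S, M.optimalReward s₁ = M.optimalReward s₂ := fun s₁ s₂ =>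
    (hle s₁ s₂).antisymm (hle s₂ s₁)
  refine ⟨hD, heq, fun s s' => ?_⟩
  obtain ⟨α, hα, happ⟩ := hN
  obtain ⟨s₀, rfl⟩ := hα s'
  rw [heq s s₀]
  refine MDP.le_of_forall_discount (K := C + C') fun β h0 h1 => ?_
  obtain ⟨V, hV⟩ := M.exists_isDiscountedOptimal h0 h1
  obtain ⟨U, hU⟩ := N.exists_isDiscountedOptimal h0 h1
  have h2 := hC β V h0 h1 hV s₀
  have h3 := hC' β U h0 h1 hU (α s₀)
  have h4 := hV.abs_sub_le hU h0 h1 hα (fun s a => ⟨(happ s a).1.le, (happ s a).2.le⟩)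
    (hV.sub_le_diameter hr hD h0 h1) s₀
  rw [abs_le] at *
  constructor <;> linarith [h2.1, h2.2, h3.1, h3.2, h4.1, h4.2]
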